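/- \textbf{Setting.} Let $a<b$, $t_0<0$ and $\Omega=\Omega(a,b,t_0):=\{(t,\theta): t_0\le t<0,\ a+t\le\theta\le b-t\}$. Let $x=(P,Q)$ be a smooth ($C^\infty$ up to the boundary points belonging to $\Omega$) solution on $\Omega$ of the Gowdy equations, i.e. of $\frac{D X_t}{Dt}-\frac{D X_\theta}{D\theta}=-\frac{X_t}{t}$ (where $X_t=\partial_t x$, $X_\theta=\partial_\theta x$) for maps into the hyperbolic plane with metric $dP^2+e^{2P}dQ^2$; in coordinates, $$\partial_t^2P-\partial_\theta^2P=-\frac{\partial_tP}{t}+e^{2P}\big((\partial_tQ)^2-(\partial_\theta Q)^2\big),$$ $$\partial_t^2Q-\partial_\theta^2Q=-\frac{\partial_tQ}{t}-2\big(\partial_tP\,\partial_tQ-\partial_\theta P\,\partial_\theta Q\big).$$ Set $f_1=\partial_tP$, $g_1=\partial_\theta P$, $f_2=e^P\partial_tQ$, $g_2=e^P\partial_\theta Q$, and $\hat\mu_\pm=\sup_\Omega|tf_1+1\pm tg_1|$. \textbf{Theorem.} Suppose that either $$\sup_\Omega\left(|tf_1+1|+\frac{|tg_2|}{2}+\frac{2|tf_2|^2}{\sqrt{1+4|tf_2|^2}+1}\right)<\frac12,$$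 or both $$\sup_\Omega\left(\hat\mu_-+|tf_1+1+tg_1|+\sqrt{(\hat\mu_-+|tf_1+1+tg_1|)^2+4|tf_2+tg_2|^2}\right)<4,$$ $$\sup_\Omega\left(\hat\mu_++|tf_1+1-tg_1|+\sqrt{(\hat\mu_++|tf_1+1-tg_1|)^2+4|tf_2-tg_2|^2}\right)<4.$$ Then there exists a continuous function $\hat v:[a,b]\to\mathbb R$ such that $$|tf_1+1|^2(t,\theta)+|tg_2|^2(t,\theta)\longrightarrow\hat v(\theta)^2\quad\text{as }t\to0^-,\ \text{uniformly in }\theta\in[a,b].$$ Moreover there exist constants $C,\epsilon>0$ such that $$|tf_2|^2+|tg_1|^2\le C|t|^{2\epsilon}\quad\text{on }\Omega.$$ -/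

import Mathlib

open Set Filter Topology
open scoped ContDiff

namespace Gowdy

noncomputable section

/-- The set of all `(t, θ)` with `t₀ ≤ t < 0` and `a + t ≤ θ ≤ b - t`.
The first coordinate of a point is `t`, the second one is `θ`. -/
def Omega (a b t₀ : ℝ) : Set (ℝ × ℝ) :=
  {p | t₀ ≤ p.1 ∧ p.1 < 0 ∧ a + p.1 ≤ p.2 ∧ p.2 ≤ b - p.1}

/-- The partial derivative in `t` on `S` (one-sided at boundary points belonging to `S`). -/
def dt (S : Set (ℝ × ℝ)) (u : ℝ × ℝ → ℝ) : ℝ × ℝ → ℝ :=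
  fun p => fderivWithin ℝ u S p (1, 0)

/-- The partial derivative in `θ` on `S` (one-sided at boundary points belonging to `S`). -/
def dθ (S : Set (ℝ × ℝ)) (u : ℝ × ℝ → ℝ) : ℝ × ℝ → ℝ :=
  fun p => fderivWithin ℝ u S p (0, 1)

/-- `(P, Q)` is a smooth solution on `S` of the Gowdy equations, i.e. of the equation
`D X_t / D t - D X_θ / D θ = - X_t / t` for a map `x = (P, Q)` into the hyperbolic plane with
metric `dP² + e^{2P} dQ²`, written out in the coordinates `(P, Q)`. -/
structure IsSolutionOn (S : Set (ℝ × ℝ)) (P Q : ℝ × ℝ → ℝ) : Prop where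
  smooth_P : ContDiffOn ℝ ∞ P S
  smooth_Q : ContDiffOn ℝ ∞ Q S
  eq_P : ∀ p ∈ S, dt S (dt S P) p - dθ S (dθ S P) p =
    - dt S P p / p.1 + Real.exp (2 * P p) * ((dt S Q p) ^ 2 - (dθ S Q p) ^ 2)
  eq_Q : ∀ p ∈ S, dt S (dt S Q) p - dθ S (dθ S Q) p =
    - dt S Q p / p.1 - 2 * (dt S P p * dt S Q p - dθ S P p * dθ S Q p)

/-- `f₁ = P_t`. -/
def f₁ (S : Set (ℝ × ℝ)) (P : ℝ × ℝ → ℝ) : ℝ × ℝ → ℝ := dt S P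

/-- `g₁ = P_θ`. -/
def g₁ (S : Set (ℝ × ℝ)) (P : ℝ × ℝ → ℝ) : ℝ × ℝ → ℝ := dθ S P

/-- `f₂ = e^P Q_t`. -/
def f₂ (S : Set (ℝ × ℝ)) (P Q : ℝ × ℝ → ℝ) : ℝ × ℝ → ℝ :=
  fun p => Real.exp (P p) * dt S Q p

/-- `g₂ = e^P Q_θ`. -/
def g₂ (S : Set (ℝ × ℝ)) (P Q : ℝ × ℝ → ℝ) : ℝ × ℝ → ℝ :=
  fun p => Real.exp (P p) * dθ S Q p

/-- `sup_S F < c`, where the supremum is required to be finite. -/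
def SupLT (S : Set (ℝ × ℝ)) (F : ℝ × ℝ → ℝ) (c : ℝ) : Prop :=
  BddAbove (F '' S) ∧ sSup (F '' S) < c

/-- The first smallness condition. -/
def CondA (S : Set (ℝ × ℝ)) (P Q : ℝ × ℝ → ℝ) : Prop :=
  SupLT S (fun p => |p.1 * f₁ S P p + 1| + |p.1 * g₂ S P Q p| / 2 +
    2 * |p.1 * f₂ S P Q p| ^ 2 / (Real.sqrt (1 + 4 * |p.1 * f₂ S P Q p| ^ 2) + 1)) (1 / 2)

/-- `μ̂₊ = sup_S |t f₁ + 1 + t g₁|`. -/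
def muPlus (S : Set (ℝ × ℝ)) (P : ℝ × ℝ → ℝ) : ℝ :=
  sSup ((fun p : ℝ × ℝ => |p.1 * f₁ S P p + 1 + p.1 * g₁ S P p|) '' S)

/-- `μ̂₋ = sup_S |t f₁ + 1 - t g₁|`. -/
def muMinus (S : Set (ℝ × ℝ)) (P : ℝ × ℝ → ℝ) : ℝ :=
  sSup ((fun p : ℝ × ℝ => |p.1 * f₁ S P p + 1 - p.1 * g₁ S P p|) '' S)

/-- The second smallness condition. Finiteness of the two suprema below forces
`t f₁ + 1 ± t g₁` to be bounded on `S`, hence `muPlus` and `muMinus` to be honest suprema. -/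
def CondB (S : Set (ℝ × ℝ)) (P Q : ℝ × ℝ → ℝ) : Prop :=
  SupLT S (fun p => muMinus S P + |p.1 * f₁ S P p + 1 + p.1 * g₁ S P p| +
    Real.sqrt ((muMinus S P + |p.1 * f₁ S P p + 1 + p.1 * g₁ S P p|) ^ 2 +
      4 * |p.1 * f₂ S P Q p + p.1 * g₂ S P Q p| ^ 2)) 4 ∧
  SupLT S (fun p => muPlus S P + |p.1 * f₁ S P p + 1 - p.1 * g₁ S P p| +
    Real.sqrt ((muPlus S P + |p.1 * f₁ S P p + 1 - p.1 * g₁ S P p|) ^ 2 +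
      4 * |p.1 * f₂ S P Q p - p.1 * g₂ S P Q p| ^ 2)) 4

end

end Gowdy

/-! Up to signs, `(U, G) = (t f₁ + 1, t g₂)` and `(H, F) = (t g₁, t f₂)` are `t` times the frame
components of the `t`- and `θ`-derivatives of a dual wave map into the hyperbolic plane. Both
smallness conditions enter only through `|U| ≤ 1 - δ`.

Three estimates carry the proof. (1) `exists_null_velocity_lt_one`: a maximum principle for `|(U, G)
± (H, F)|²`, corrected by a small multiple of `U ± H`, makes these null velocities have squared
length at most some `E < 1` near `t = 0`. (2) `exists_weighted_bound`: the curvature term in the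
evolution of the covariant `θ`-derivatives is then small enough to be absorbed by a weight `|t| ^ (2
k)` with `k < 1`. A joint maximum principle bounds these derivatives and `(H, F) / t` by a constant
times `|t| ^ (-k)`. (3) `asymptotics`: hence `|(H, F)|² ≤ C |t| ^ (2 (1 - k))`, and `∂ₜ(U² + G²)` is
`O(|t| ^ (-k))`, which is integrable, so `U² + G²` converges uniformly. -/

namespace Gowdy

/-! ### Calculus of partial derivatives within a set. -/

/-- `u` has a derivative within `S` at `p` whose partial derivatives are `x` (in `t`) and
`y` (in `θ`). -/
def HasPD (S : Set (ℝ × ℝ)) (u : ℝ × ℝ → ℝ) (x y : ℝ) (p : ℝ × ℝ) : Prop :=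
  ∃ L : ℝ × ℝ →L[ℝ] ℝ, HasFDerivWithinAt u L S p ∧ L (1, 0) = x ∧ L (0, 1) = y

namespace HasPD

variable {S : Set (ℝ × ℝ)} {u v : ℝ × ℝ → ℝ} {x y x' y' : ℝ} {p : ℝ × ℝ}

lemma congr_val (h : HasPD S u x y p) (hx : x = x') (hy : y = y') : HasPD S u x' y' p :=
  hx ▸ hy ▸ h

lemma add (hu : HasPD S u x y p) (hv : HasPD S v x' y' p) :
    HasPD S (fun q => u q + v q) (x + x') (y + y') p := by
  obtain ⟨L, hL, rfl, rfl⟩ := hu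
  obtain ⟨M, hM, rfl, rfl⟩ := hv
  exact ⟨L + M, hL.add hM, rfl, rfl⟩

lemma sub (hu : HasPD S u x y p) (hv : HasPD S v x' y' p) :
    HasPD S (fun q => u q - v q) (x - x') (y - y') p := by
  obtain ⟨L, hL, rfl, rfl⟩ := hu
  obtain ⟨M, hM, rfl, rfl⟩ := hv
  exact ⟨L - M, hL.sub hM, rfl, rfl⟩

lemma mul (hu : HasPD S u x y p) (hv : HasPD S v x' y' p) :
    HasPD S (fun q => u q * v q) (u p * x' + v p * x) (u p * y' + v p * y) p := by
  obtain ⟨L, hL, rfl, rfl⟩ := hu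
  obtain ⟨M, hM, rfl, rfl⟩ := hv
  exact ⟨u p • M + v p • L, hL.mul hM, by simp, by simp⟩

lemma comp {g : ℝ → ℝ} {g' : ℝ} (hu : HasPD S u x y p) (hg : HasDerivAt g g' (u p)) :
    HasPD S (fun q => g (u q)) (g' * x) (g' * y) p := by
  obtain ⟨L, hL, rfl, rfl⟩ := hu
  exact ⟨g' • L, hg.comp_hasFDerivWithinAt p hL, by simp, by simp⟩

lemma const (c : ℝ) : HasPD S (fun _ => c) 0 0 p :=
  ⟨0, hasFDerivWithinAt_const c p S, rfl, rfl⟩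

lemma fst : HasPD S (fun q => q.1) 1 0 p :=
  ⟨ContinuousLinearMap.fst ℝ ℝ ℝ, hasFDerivWithinAt_fst, rfl, rfl⟩

lemma continuousWithinAt (h : HasPD S u x y p) : ContinuousWithinAt u S p :=
  h.choose_spec.1.continuousWithinAt

lemma of_differentiableWithinAt (h : DifferentiableWithinAt ℝ u S p) :
    HasPD S u (dt S u p) (dθ S u p) p :=
  ⟨_, h.hasFDerivWithinAt, rfl, rfl⟩

lemma eq_dt (h : HasPD S u x y p) (hS : UniqueDiffWithinAt ℝ S p) : dt S u p = x := by
  obtain ⟨L, hL, rfl, rfl⟩ := h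
  rw [dt, hL.fderivWithin hS]

lemma eq_dθ (h : HasPD S u x y p) (hS : UniqueDiffWithinAt ℝ S p) : dθ S u p = y := by
  obtain ⟨L, hL, rfl, rfl⟩ := h
  rw [dθ, hL.fderivWithin hS]

lemma congr_on (h : HasPD S u x y p) (huv : ∀ q ∈ S, v q = u q) (hp : p ∈ S) :
    HasPD S v x y p := by
  obtain ⟨L, hL, h1, h2⟩ := h
  exact ⟨L, hL.congr huv (huv p hp), h1, h2⟩

end HasPD

/-! ### Geometry of the domain and the maximum principle. -/

section Domain

variable {a b t₀ : ℝ}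

lemma convex_Omega : Convex ℝ (Omega a b t₀) := by
  rintro ⟨t, x⟩ ⟨h1, h2, h3, h4⟩ ⟨s, y⟩ ⟨k1, k2, k3, k4⟩ c d hc hd hcd
  simp only [Prod.smul_mk, Prod.mk_add_mk, smul_eq_mul, Omega, mem_ofPred_eq] at *
  obtain rfl : d = 1 - c := by linarith
  refine ⟨by nlinarith, ?_, by nlinarith, by nlinarith⟩
  rcases hc.eq_or_lt with rfl | hc
  · linarith
  · nlinarith [mul_neg_of_pos_of_neg hc h2, mul_nonneg hd (neg_nonneg.2 k2.le)]

lemma nonempty_interior_Omega (hab : a < b) (ht₀ : t₀ < 0) :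
    (interior (Omega a b t₀)).Nonempty := by
  refine ⟨(t₀ / 2, (a + b) / 2), mem_interior.2 ⟨Ioo t₀ 0 ×ˢ Ioo a b, ?_,
    isOpen_Ioo.prod isOpen_Ioo, ⟨by constructor <;> simp <;> linarith,
      by constructor <;> simp <;> linarith⟩⟩⟩
  rintro ⟨t, x⟩ ⟨⟨h1, h2⟩, h3, h4⟩
  simp only [Omega, mem_ofPred_eq] at *
  refine ⟨h1.le, h2, by linarith, by linarith⟩

lemma uniqueDiffOn_Omega (hab : a < b) (ht₀ : t₀ < 0) :
    UniqueDiffOn ℝ (Omega a b t₀) :=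
  uniqueDiffOn_convex convex_Omega (nonempty_interior_Omega hab ht₀)

/-- `Omega` fails to be closed only through the condition `t < 0`, which `t ≤ T` makes redundant. -/
lemma isCompact_slab {t₁ T : ℝ} (hT : T < 0) :
    IsCompact {p ∈ Omega a b t₀ | t₁ ≤ p.1 ∧ p.1 ≤ T} := by
  have h : IsClosed {p : ℝ × ℝ | t₀ ≤ p.1 ∧ a + p.1 ≤ p.2 ∧ p.2 ≤ b - p.1 ∧
      t₁ ≤ p.1 ∧ p.1 ≤ T} := by
    simp only [ofPred_and]
    refine .inter ?_ (.inter ?_ (.inter ?_ (.inter ?_ ?_))) <;>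
      exact isClosed_le (by fun_prop) (by fun_prop)
  refine ((isCompact_Icc (a := ((t₀, a + t₀) : ℝ × ℝ)) (b := (T, b - t₀))).inter_right h).of_isClosed_subset
    ?_ ?_
  · convert h using 1
    ext p
    simp only [Omega, mem_ofPred_eq]
    constructor
    · rintro ⟨⟨h1, h2, h3, h4⟩, h5, h6⟩
      exact ⟨h1, h3, h4, h5, h6⟩
    · rintro ⟨h1, h3, h4, h5, h6⟩
      exact ⟨⟨h1, by linarith, h3, h4⟩, h5, h6⟩
  · rintro ⟨t, x⟩ ⟨⟨h1, h2, h3, h4⟩, h5, h6⟩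
    simp only at *
    refine ⟨⟨⟨h1, by simp; linarith⟩, ⟨h6, by simp; linarith⟩⟩, h1, h3, h4, h5, h6⟩

/-- Maximum principle: the maximum of a finite family over a slab of `Omega` is attained on the
initial slice, or at a point where the derivative along a backward causal direction has a sign. -/
lemma exists_max_slab {ι : Type*} [Finite ι] [Nonempty ι] {t₁ T : ℝ} (hab : a < b)
    (ht : t₀ ≤ t₁) (htT : t₁ ≤ T) (hT : T < 0) (σ : ι → ℝ) (hσ : ∀ i, |σ i| ≤ 1)
    (φ x y : ι → ℝ × ℝ → ℝ)
    (hφ : ∀ i, ∀ p ∈ Omega a b t₀, HasPD (Omega a b t₀) (φ i) (x i p) (y i p) p) :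
    ∃ i, ∃ p ∈ Omega a b t₀, t₁ ≤ p.1 ∧ p.1 ≤ T ∧
      (∀ j, ∀ q ∈ Omega a b t₀, t₁ ≤ q.1 → q.1 ≤ T → φ j q ≤ φ i p) ∧
      (p.1 = t₁ ∨ 0 ≤ x i p - σ i * y i p) := by
  set K := {p ∈ Omega a b t₀ | t₁ ≤ p.1 ∧ p.1 ≤ T} with hK
  have hKc : IsCompact K := isCompact_slab hT
  have hKn : K.Nonempty := by
    refine ⟨(t₁, a), ⟨ht, by simp; linarith, ?_, ?_⟩, le_refl _, htT⟩ <;> simp <;> linarith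
  have hcont : ∀ i, ContinuousOn (φ i) K := fun i p hp =>
    (hφ i p hp.1).continuousWithinAt.mono (sep_subset _ _)
  choose m hmK hm using fun i => hKc.exists_isMaxOn hKn (hcont i)
  obtain ⟨i, hi⟩ := Finite.exists_max fun i => φ i (m i)
  refine ⟨i, m i, (hmK i).1, (hmK i).2.1, (hmK i).2.2,
    fun j q hq h1 h2 => (hm j ⟨hq, h1, h2⟩).trans (hi j), ?_⟩
  rcases (hmK i).2.1.eq_or_lt with h | h
  · exact Or.inl h.symm
  right
  obtain ⟨⟨h1, h2, h3, h4⟩, h5, h6⟩ := hmK i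
  have hs := abs_le.1 (hσ i)
  have hKconv : Convex ℝ K := by
    have : K = Omega a b t₀ ∩ (Prod.fst ⁻¹' Icc t₁ T) := rfl
    rw [this]
    exact convex_Omega.inter
      ((convex_Icc t₁ T).is_linear_preimage (IsLinearMap.mk (fun _ _ => rfl) fun _ _ => rfl))
  -- `Omega` widens at unit speed towards the past, so a backward segment of slope at most one stays
  -- in the slab, even from a boundary point.
  have hq : (t₁, (m i).2 + σ i * ((m i).1 - t₁)) ∈ K := by
    refine ⟨⟨ht, by simp; linarith, ?_, ?_⟩, le_refl _, htT⟩ <;> simp <;> nlinarith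
  have hseg := hKconv.segment_subset (hmK i) hq
  obtain ⟨L, hL, hLx, hLy⟩ := hφ i (m i) (hmK i).1
  have hneg := (hm i).localize.hasFDerivWithinAt_nonpos (hL.mono (sep_subset _ _))
    (sub_mem_posTangentConeAt_of_segment_subset hseg)
  have hdir : (t₁, (m i).2 + σ i * ((m i).1 - t₁)) - m i =
      (t₁ - (m i).1) • ((1, 0) : ℝ × ℝ) + (σ i * ((m i).1 - t₁)) • ((0, 1) : ℝ × ℝ) := by
    ext <;> simp
  -- The derivative at the maximum is nonpositive along this segment; the factor `t₁ - t < 0`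
  -- reverses the sign.
  rw [hdir, map_add, map_smul, map_smul, hLx, hLy, smul_eq_mul, smul_eq_mul] at hneg
  by_contra! hlt
  nlinarith

lemma exists_bound_slab {T : ℝ} (hT : T < 0) {u : ℝ × ℝ → ℝ} (hu : ContinuousOn u (Omega a b t₀)) :
    ∃ M, 0 ≤ M ∧ ∀ p ∈ Omega a b t₀, p.1 ≤ T → u p ≤ M := by
  obtain ⟨M, hM⟩ := (isCompact_slab (a := a) (b := b) (t₀ := t₀) (t₁ := t₀) hT).bddAbove_image
    (hu.mono (sep_subset _ _))
  exact ⟨max M 0, le_max_right _ _, fun p hp h =>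
    (hM ⟨p, ⟨hp, hp.1, h⟩, rfl⟩).trans (le_max_left _ _)⟩

end Domain

/-! ### Smoothness of partial derivatives and their commutation. -/

section Smooth

variable {a b t₀ : ℝ} {u : ℝ × ℝ → ℝ}

lemma contDiffOn_dt (hab : a < b) (ht₀ : t₀ < 0) (hu : ContDiffOn ℝ ∞ u (Omega a b t₀)) :
    ContDiffOn ℝ ∞ (dt (Omega a b t₀) u) (Omega a b t₀) :=
  (hu.fderivWithin (m := ∞) (uniqueDiffOn_Omega hab ht₀) le_rfl).clm_apply contDiffOn_const

lemma contDiffOn_dθ (hab : a < b) (ht₀ : t₀ < 0) (hu : ContDiffOn ℝ ∞ u (Omega a b t₀)) :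
    ContDiffOn ℝ ∞ (dθ (Omega a b t₀) u) (Omega a b t₀) :=
  (hu.fderivWithin (m := ∞) (uniqueDiffOn_Omega hab ht₀) le_rfl).clm_apply contDiffOn_const

lemma hasPD_of_contDiffOn {p : ℝ × ℝ} (hu : ContDiffOn ℝ ∞ u (Omega a b t₀))
    (hp : p ∈ Omega a b t₀) :
    HasPD (Omega a b t₀) u (dt (Omega a b t₀) u p) (dθ (Omega a b t₀) u p) p :=
  .of_differentiableWithinAt ((hu.differentiableOn (by simp)) p hp)

/-- Symmetry persists at boundary points because a convex set with nonempty interior lies in the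
closure of its interior. -/
lemma dt_dθ_comm {p : ℝ × ℝ} (hab : a < b) (ht₀ : t₀ < 0) (hu : ContDiffOn ℝ ∞ u (Omega a b t₀))
    (hp : p ∈ Omega a b t₀) :
    dt (Omega a b t₀) (dθ (Omega a b t₀) u) p = dθ (Omega a b t₀) (dt (Omega a b t₀) u) p := by
  have hU := uniqueDiffOn_Omega hab ht₀
  have hsymm : IsSymmSndFDerivWithinAt ℝ u (Omega a b t₀) p := by
    refine (hu p hp).isSymmSndFDerivWithinAt (by simpa using ENat.LEInfty.out) hU ?_ hp
    rw [convex_Omega.closure_interior_eq_closure_of_nonempty_interior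
      (nonempty_interior_Omega hab ht₀)]
    exact subset_closure hp
  have hd : HasFDerivWithinAt (fderivWithin ℝ u (Omega a b t₀))
      (fderivWithin ℝ (fderivWithin ℝ u (Omega a b t₀)) (Omega a b t₀) p) (Omega a b t₀) p :=
    (((hu.fderivWithin (m := ∞) hU le_rfl).differentiableOn (by simp)) p hp).hasFDerivWithinAt
  have key : ∀ v w : ℝ × ℝ, fderivWithin ℝ (fun q => fderivWithin ℝ u (Omega a b t₀) q v)
      (Omega a b t₀) p w =
      fderivWithin ℝ (fderivWithin ℝ u (Omega a b t₀)) (Omega a b t₀) p w v := by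
    intro v w
    have := (ContinuousLinearMap.apply ℝ ℝ v).hasFDerivAt.comp_hasFDerivWithinAt p hd
    rw [show (fun q => fderivWithin ℝ u (Omega a b t₀) q v) =
      (ContinuousLinearMap.apply ℝ ℝ v) ∘ fderivWithin ℝ u (Omega a b t₀) from rfl,
      this.fderivWithin (hU p hp)]
    rfl
  unfold dt dθ
  rw [key, key]
  exact hsymm _ _

end Smooth

/-! ### The first order system and its null derivatives. -/

/-- The Gowdy equations as a first order system for `U = t f₁ + 1`, `G = t g₂`, `H = t g₁`,
`F = t f₂`. -/
structure FirstOrderSystem (S : Set (ℝ × ℝ)) (U G H F : ℝ × ℝ → ℝ) : Prop where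
  smooth_U : ContDiffOn ℝ ∞ U S
  smooth_G : ContDiffOn ℝ ∞ G S
  smooth_H : ContDiffOn ℝ ∞ H S
  smooth_F : ContDiffOn ℝ ∞ F S
  eq_U : ∀ p ∈ S, p.1 * dt S U p = p.1 * dθ S H p + F p ^ 2 - G p ^ 2
  eq_G : ∀ p ∈ S, p.1 * dt S G p = U p * G p - H p * F p + p.1 * dθ S F p
  eq_H : ∀ p ∈ S, p.1 * dt S H p = H p + p.1 * dθ S U p
  eq_F : ∀ p ∈ S, p.1 * dt S F p = F p - U p * F p + H p * G p + p.1 * dθ S G p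

section

variable {a b t₀ : ℝ}

/-- The equations for `U` and `F` are the two wave equations; those for `G` and `H` express the
symmetry of second derivatives. -/
lemma IsSolutionOn.firstOrderSystem (hab : a < b) (ht₀ : t₀ < 0) {P Q : ℝ × ℝ → ℝ}
    (hx : IsSolutionOn (Omega a b t₀) P Q) :
    FirstOrderSystem (Omega a b t₀) (fun p => p.1 * f₁ (Omega a b t₀) P p + 1)
      (fun p => p.1 * g₂ (Omega a b t₀) P Q p) (fun p => p.1 * g₁ (Omega a b t₀) P p)
      (fun p => p.1 * f₂ (Omega a b t₀) P Q p) := by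
  have hP := hx.smooth_P
  have hQ := hx.smooth_Q
  have hPt := contDiffOn_dt hab ht₀ hP
  have hPx := contDiffOn_dθ hab ht₀ hP
  have hQt := contDiffOn_dt hab ht₀ hQ
  have hQx := contDiffOn_dθ hab ht₀ hQ
  have hE : ContDiffOn ℝ ∞ (fun p => Real.exp (P p)) (Omega a b t₀) := hP.exp
  have h1 : ContDiffOn ℝ ∞ (fun p : ℝ × ℝ => p.1) (Omega a b t₀) := contDiff_fst.contDiffOn
  have hU := uniqueDiffOn_Omega hab ht₀
  have dU := fun p hp => HasPD.fst.mul (hasPD_of_contDiffOn (p := p) hPt hp) |>.add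
    (HasPD.const 1)
  have dH := fun p hp => HasPD.fst.mul (hasPD_of_contDiffOn (p := p) hPx hp)
  have dE := fun p hp => (hasPD_of_contDiffOn (p := p) hP hp).comp (Real.hasDerivAt_exp (P p))
  have dF := fun p hp => HasPD.fst.mul ((dE p hp).mul (hasPD_of_contDiffOn (p := p) hQt hp))
  have dG := fun p hp => HasPD.fst.mul ((dE p hp).mul (hasPD_of_contDiffOn (p := p) hQx hp))
  have hexp : ∀ p, Real.exp (2 * P p) = Real.exp (P p) ^ 2 := fun p => by
    rw [← Real.exp_nat_mul]; norm_num
  refine ⟨(h1.mul hPt).add contDiffOn_const, h1.mul (hE.mul hQx), h1.mul hPx,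
    h1.mul (hE.mul hQt), fun p hp => ?_, fun p hp => ?_, fun p hp => ?_, fun p hp => ?_⟩
  all_goals
    have hne : p.1 ≠ 0 := hp.2.1.ne
    simp only [f₁, f₂, g₁, g₂]
  · rw [(dU p hp).eq_dt (hU p hp), (dH p hp).eq_dθ (hU p hp)]
    have := hx.eq_P p hp
    rw [hexp] at this
    field_simp at this
    linear_combination p.1 * this
  · rw [(dG p hp).eq_dt (hU p hp), (dF p hp).eq_dθ (hU p hp), dt_dθ_comm hab ht₀ hQ hp]
    ring
  · rw [(dH p hp).eq_dt (hU p hp), (dU p hp).eq_dθ (hU p hp), dt_dθ_comm hab ht₀ hP hp]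
    ring
  · rw [(dF p hp).eq_dt (hU p hp), (dG p hp).eq_dθ (hU p hp)]
    have := hx.eq_Q p hp
    field_simp at this
    linear_combination p.1 * Real.exp (P p) * this

variable {U G H F : ℝ × ℝ → ℝ}

namespace FirstOrderSystem

/-- Squared velocity in a null direction (`σ = ± 1`) with a linear correction. -/
lemma null_deriv_sq
    (h : FirstOrderSystem (Omega a b t₀) U G H F) {σ : ℝ} (hσ : σ * σ = 1) (l : ℝ)
    {p : ℝ × ℝ} (hp : p ∈ Omega a b t₀) :
    ∃ x y, HasPD (Omega a b t₀) (fun q => (U q + σ * H q) * (U q + σ * H q) +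
      (G q + σ * F q) * (G q + σ * F q) - l * (U q + σ * H q)) x y p ∧
      p.1 * (x - σ * y) = 2 * σ * (U p * H p + G p * F p) - l * σ * H p + 2 * H p ^ 2
        + (2 - l) * F p ^ 2 + l * G p ^ 2 := by
  have dU := hasPD_of_contDiffOn h.smooth_U hp
  have dG := hasPD_of_contDiffOn h.smooth_G hp
  have dH := (HasPD.const σ).mul (hasPD_of_contDiffOn h.smooth_H hp)
  have dF := (HasPD.const σ).mul (hasPD_of_contDiffOn h.smooth_F hp)
  refine ⟨_, _, (((dU.add dH).mul (dU.add dH)).add ((dG.add dF).mul (dG.add dF))).sub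
    ((HasPD.const l).mul (dU.add dH)), ?_⟩
  have e1 := h.eq_U p hp
  have e2 := h.eq_G p hp
  have e3 := h.eq_H p hp
  have e4 := h.eq_F p hp
  have hσ' : σ ^ 2 = 1 := by rw [sq, hσ]
  linear_combination (2 * (U p + σ * H p) - l) * (e1 + σ * e3)
    + (2 * (G p + σ * F p)) * (e2 + σ * e4) - p.1 * ((2 * (U p + σ * H p) - l) * dθ (Omega a b t₀) H p + (2 * (G p + σ * F p)) * dθ (Omega a b t₀) F p) * hσ' + (2 * H p ^ 2
        + 2 * F p ^ 2 - 2 * U p * F p ^ 2 + 2 * H p * G p * F p) * hσ'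

end FirstOrderSystem

end

/-! ### Covariant derivatives and their evolution. -/

/-- First component of the covariant `θ`-derivative of the field with frame components `(u, v)`. -/
noncomputable def cov₁ (S : Set (ℝ × ℝ)) (F u v : ℝ × ℝ → ℝ) : ℝ × ℝ → ℝ :=
  fun q => dθ S u q + F q * q.1⁻¹ * v q

/-- Second component of the covariant `θ`-derivative of the field with frame components
`(u, v)`. -/
noncomputable def cov₂ (S : Set (ℝ × ℝ)) (F u v : ℝ × ℝ → ℝ) : ℝ × ℝ → ℝ :=
  fun q => dθ S v q - F q * q.1⁻¹ * u q

lemma HasPD.inv_fst {S : Set (ℝ × ℝ)} {p : ℝ × ℝ} (hp : p.1 ≠ 0) :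
    HasPD S (fun q => q.1⁻¹) (-(p.1 ^ 2)⁻¹ * 1) (-(p.1 ^ 2)⁻¹ * 0) p :=
  HasPD.fst.comp (hasDerivAt_inv hp)

namespace FirstOrderSystem

variable {a b t₀ : ℝ} {U G H F : ℝ × ℝ → ℝ}

lemma dt_U (h : FirstOrderSystem (Omega a b t₀) U G H F) {p : ℝ × ℝ}
    (hp : p ∈ Omega a b t₀) : dt (Omega a b t₀) U p =
    dθ (Omega a b t₀) H p + (F p * F p - G p * G p) * p.1⁻¹ := by
  have := h.eq_U p hp
  have hne : p.1 ≠ 0 := hp.2.1.ne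
  field_simp
  linear_combination this

lemma dt_G (h : FirstOrderSystem (Omega a b t₀) U G H F) {p : ℝ × ℝ}
    (hp : p ∈ Omega a b t₀) : dt (Omega a b t₀) G p =
    dθ (Omega a b t₀) F p + (U p * G p - H p * F p) * p.1⁻¹ := by
  have := h.eq_G p hp
  have hne : p.1 ≠ 0 := hp.2.1.ne
  field_simp
  linear_combination this

lemma dt_H (h : FirstOrderSystem (Omega a b t₀) U G H F) {p : ℝ × ℝ}
    (hp : p ∈ Omega a b t₀) : dt (Omega a b t₀) H p = dθ (Omega a b t₀) U p + H p * p.1⁻¹ := by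
  have := h.eq_H p hp
  have hne : p.1 ≠ 0 := hp.2.1.ne
  field_simp
  linear_combination this

lemma dt_F (h : FirstOrderSystem (Omega a b t₀) U G H F) {p : ℝ × ℝ}
    (hp : p ∈ Omega a b t₀) : dt (Omega a b t₀) F p =
    dθ (Omega a b t₀) G p + (F p + (H p * G p - U p * F p)) * p.1⁻¹ := by
  have := h.eq_F p hp
  have hne : p.1 ≠ 0 := hp.2.1.ne
  field_simp
  linear_combination this

/-- Evolution of the length of the covariant derivative of a null velocity (`σ = ± 1`). -/
lemma null_deriv_cov (hab : a < b) (ht₀ : t₀ < 0)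
    (h : FirstOrderSystem (Omega a b t₀) U G H F) {σ : ℝ} (hσ : σ * σ = 1)
    {p : ℝ × ℝ} (hp : p ∈ Omega a b t₀) :
    ∃ x y, HasPD (Omega a b t₀) (fun q =>
      (cov₁ (Omega a b t₀) F U G q + σ * cov₁ (Omega a b t₀) F H F q) *
      (cov₁ (Omega a b t₀) F U G q + σ * cov₁ (Omega a b t₀) F H F q) +
      (cov₂ (Omega a b t₀) F U G q + σ * cov₂ (Omega a b t₀) F H F q) *
      (cov₂ (Omega a b t₀) F U G q + σ * cov₂ (Omega a b t₀) F H F q)) x y p ∧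
      p.1 * (x - σ * y) =
        2 * σ * ((cov₁ (Omega a b t₀) F U G p + σ * cov₁ (Omega a b t₀) F H F p) *
            cov₁ (Omega a b t₀) F H F p +
          (cov₂ (Omega a b t₀) F U G p + σ * cov₂ (Omega a b t₀) F H F p) *
            cov₂ (Omega a b t₀) F H F p) +
        2 * ((H p * G p - F p * U p) * p.1⁻¹) *
          ((cov₁ (Omega a b t₀) F U G p + σ * cov₁ (Omega a b t₀) F H F p) * (G p + σ * F p) -
          (cov₂ (Omega a b t₀) F U G p + σ * cov₂ (Omega a b t₀) F H F p) *
            (U p + σ * H p)) := by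
  have hne : p.1 ≠ 0 := hp.2.1.ne
  have hU := uniqueDiffOn_Omega hab ht₀ p hp
  have dU := hasPD_of_contDiffOn h.smooth_U hp
  have dG := hasPD_of_contDiffOn h.smooth_G hp
  have dH := hasPD_of_contDiffOn h.smooth_H hp
  have dF := hasPD_of_contDiffOn h.smooth_F hp
  have dUx := hasPD_of_contDiffOn (contDiffOn_dθ hab ht₀ h.smooth_U) hp
  have dGx := hasPD_of_contDiffOn (contDiffOn_dθ hab ht₀ h.smooth_G) hp
  have dHx := hasPD_of_contDiffOn (contDiffOn_dθ hab ht₀ h.smooth_H) hp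
  have dFx := hasPD_of_contDiffOn (contDiffOn_dθ hab ht₀ h.smooth_F) hp
  have dI : HasPD (Omega a b t₀) _ _ _ p := HasPD.inv_fst hne
  have mU := (((dHx.add (((dF.mul dF).sub (dG.mul dG)).mul dI)).congr_on
    (fun q hq => h.dt_U hq) hp)).eq_dθ hU
  have mG := (((dFx.add (((dU.mul dG).sub (dH.mul dF)).mul dI)).congr_on
    (fun q hq => h.dt_G hq) hp)).eq_dθ hU
  have mH := ((dUx.add (dH.mul dI)).congr_on (fun q hq => h.dt_H hq) hp).eq_dθ hU
  have mF := ((dGx.add ((dF.add ((dH.mul dG).sub (dU.mul dF))).mul dI)).congr_on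
    (fun q hq => h.dt_F hq) hp).eq_dθ hU
  rw [dt_dθ_comm hab ht₀ h.smooth_U hp, mU] at dUx
  rw [dt_dθ_comm hab ht₀ h.smooth_G hp, mG] at dGx
  rw [dt_dθ_comm hab ht₀ h.smooth_H hp, mH] at dHx
  rw [dt_dθ_comm hab ht₀ h.smooth_F hp, mF] at dFx
  rw [h.dt_U hp] at dU
  rw [h.dt_G hp] at dG
  rw [h.dt_H hp] at dH
  rw [h.dt_F hp] at dF
  have dC1 := (dUx.add ((dF.mul dI).mul dG)).add
    ((HasPD.const σ).mul (dHx.add ((dF.mul dI).mul dF)))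
  have dC2 := (dGx.sub ((dF.mul dI).mul dU)).add
    ((HasPD.const σ).mul (dFx.sub ((dF.mul dI).mul dH)))
  refine ⟨_, _, (dC1.mul dC1).add (dC2.mul dC2), ?_⟩
  clear dU dG dH dF dUx dGx dHx dFx dI mU mG mH mF dC1 dC2 hU
  simp only [cov₁, cov₂]
  generalize U p = u, G p = g, H p = k, F p = f, dθ (Omega a b t₀) U p = ux,
    dθ (Omega a b t₀) G p = gx, dθ (Omega a b t₀) H p = kx, dθ (Omega a b t₀) F p = fx,
    dθ (Omega a b t₀) (dθ (Omega a b t₀) U) p = uxx,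
    dθ (Omega a b t₀) (dθ (Omega a b t₀) G) p = gxx,
    dθ (Omega a b t₀) (dθ (Omega a b t₀) H) p = kxx,
    dθ (Omega a b t₀) (dθ (Omega a b t₀) F) p = fxx
  rcases mul_self_eq_one_iff.1 hσ with rfl | rfl
  · field_simp
    ring
  · field_simp
    ring

/-- Evolution of the length of the spatial derivative `(g₁, f₂)`. -/
lemma time_deriv_space (h : FirstOrderSystem (Omega a b t₀) U G H F)
    {p : ℝ × ℝ} (hp : p ∈ Omega a b t₀) :
    ∃ x y, HasPD (Omega a b t₀) (fun q => (H q * q.1⁻¹) * (H q * q.1⁻¹) +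
      (F q * q.1⁻¹) * (F q * q.1⁻¹)) x y p ∧
      p.1 * x = 2 * (H p * p.1⁻¹ * cov₁ (Omega a b t₀) F U G p +
        F p * p.1⁻¹ * cov₂ (Omega a b t₀) F U G p) := by
  have hne : p.1 ≠ 0 := hp.2.1.ne
  have dH := hasPD_of_contDiffOn h.smooth_H hp
  have dF := hasPD_of_contDiffOn h.smooth_F hp
  have dI : HasPD (Omega a b t₀) _ _ _ p := HasPD.inv_fst hne
  rw [h.dt_H hp] at dH
  rw [h.dt_F hp] at dF
  refine ⟨_, _, ((dH.mul dI).mul (dH.mul dI)).add ((dF.mul dI).mul (dF.mul dI)), ?_⟩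
  simp only [cov₁, cov₂]
  field_simp
  ring

/-- Evolution of the squared velocity `U² + G²`. -/
lemma time_deriv_velocity (h : FirstOrderSystem (Omega a b t₀) U G H F)
    {p : ℝ × ℝ} (hp : p ∈ Omega a b t₀) :
    ∃ y, HasPD (Omega a b t₀) (fun q => U q * U q + G q * G q)
      (2 * (U p * cov₁ (Omega a b t₀) F H F p + G p * cov₂ (Omega a b t₀) F H F p)) y p := by
  have hne : p.1 ≠ 0 := hp.2.1.ne
  have dU := hasPD_of_contDiffOn h.smooth_U hp
  have dG := hasPD_of_contDiffOn h.smooth_G hp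
  rw [h.dt_U hp] at dU
  rw [h.dt_G hp] at dG
  refine ⟨_, ((dU.mul dU).add (dG.mul dG)).congr_val ?_ rfl⟩
  simp only [cov₁, cov₂]
  field_simp
  ring

end FirstOrderSystem

/-! ### Null velocities bounded away from one. -/

namespace FirstOrderSystem

variable {a b t₀ : ℝ} {U G H F : ℝ × ℝ → ℝ}

/-- When only `u` can be large, the three terms are at most `1 - 7δ/8`, `δ²/16` and `δ/16`. -/
lemma corrected_velocity_sq_le {δ σ u g k f : ℝ} (hδ : 0 < δ) (hδ1 : δ ≤ 1) (hσ : σ * σ = 1)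
    (hu : |u| ≤ 1 - δ) (hg : |g| ≤ δ / 8) (hk : |k| ≤ δ / 8) (hf : |f| ≤ δ / 8) :
    (u + σ * k) * (u + σ * k) + (g + σ * f) * (g + σ * f) - δ / 16 * (u + σ * k) ≤
      1 - 3 * δ / 4 := by
  have hsabs : |σ| = 1 := by
    rcases mul_self_eq_one_iff.1 hσ with rfl | rfl <;> simp
  have b1 : |u + σ * k| ≤ 1 - δ + δ / 8 := by
    refine (abs_add_le _ _).trans (add_le_add hu ?_)
    rwa [abs_mul, hsabs, one_mul]
  have b2 : |g + σ * f| ≤ δ / 4 := by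
    refine (abs_add_le _ _).trans ?_
    rw [abs_mul, hsabs, one_mul]
    linarith
  have c1 : (u + σ * k) * (u + σ * k) ≤ 1 - δ + δ / 8 := by
    rw [← abs_mul_abs_self]
    nlinarith [abs_nonneg (u + σ * k)]
  have c2 : (g + σ * f) * (g + σ * f) ≤ δ / 4 * (δ / 4) := by
    rw [← abs_mul_abs_self]
    exact mul_self_le_mul_self (abs_nonneg _) b2
  have c3 : - (δ / 16 * (u + σ * k)) ≤ δ / 16 * 1 := by
    rw [← mul_neg]
    exact mul_le_mul_of_nonneg_left (by linarith [neg_abs_le (u + σ * k)]) (by linarith)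
  have c4 : δ * δ ≤ δ := by nlinarith
  linarith

/-- If `|U|` is bounded away from `1`, then the null velocities are eventually bounded
away from `1`. -/
lemma exists_null_velocity_lt_one (hab : a < b) (ht₀ : t₀ < 0)
    (h : FirstOrderSystem (Omega a b t₀) U G H F) {δ : ℝ} (hδ : 0 < δ)
    (hU : ∀ p ∈ Omega a b t₀, |U p| ≤ 1 - δ) :
    ∃ t₁, t₀ ≤ t₁ ∧ t₁ < 0 ∧ ∃ E, 0 < E ∧ E < 1 ∧ ∀ σ : ℝ, σ * σ = 1 →
      ∀ p ∈ Omega a b t₀, t₁ ≤ p.1 →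
        (U p + σ * H p) * (U p + σ * H p) + (G p + σ * F p) * (G p + σ * F p) ≤ E := by
  have hδ1 : δ ≤ 1 := by
    have := hU (t₀, a) ⟨le_refl _, ht₀, by simp; linarith, by simp; linarith⟩
    linarith [abs_nonneg (U (t₀, a))]
  -- The correction `-l (U ± H)` produces the term `l G²`; without it the null derivative would
  -- control only `H` and `F`. The value `η = l ν²` is what forces `|G|, |H|, |F| ≤ ν`.
  set l := δ / 16 with hl
  set ν := δ / 8 with hν
  set η := l * ν ^ 2 with hη
  have hη0 : 0 < η := by positivity
  let s : Bool → ℝ := fun i => if i then 1 else -1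
  have hs : ∀ i, s i * s i = 1 := by intro i; cases i <;> simp [s]
  let ψ : Bool → ℝ × ℝ → ℝ := fun i q => (U q + s i * H q) * (U q + s i * H q) +
      (G q + s i * F q) * (G q + s i * F q) - l * (U q + s i * H q)
  have key : ∀ i, ∀ p : ℝ × ℝ, ∃ x y, p ∈ Omega a b t₀ → HasPD (Omega a b t₀) (ψ i) x y p ∧
      p.1 * (x - s i * y) = 2 * s i * (U p * H p + G p * F p) - l * s i * H p + 2 * H p ^ 2
        + (2 - l) * F p ^ 2 + l * G p ^ 2 := by
    intro i p
    by_cases hp : p ∈ Omega a b t₀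
    · obtain ⟨x, y, hxy⟩ := h.null_deriv_sq (hs i) l hp
      exact ⟨x, y, fun _ => hxy⟩
    · exact ⟨0, 0, fun hp' => absurd hp' hp⟩
  choose x y hxy using key
  have hlog : ∀ p ∈ Omega a b t₀, HasPD (Omega a b t₀) (fun q => Real.log q.1)
      (p.1⁻¹ * 1) (p.1⁻¹ * 0) p := fun p hp =>
    HasPD.fst.comp (Real.hasDerivAt_log hp.2.1.ne)
  have hM : ∀ i, ∃ M, 0 ≤ M ∧ ∀ p ∈ Omega a b t₀, p.1 ≤ t₀ → ψ i p ≤ M := fun i =>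
    exists_bound_slab ht₀ fun p hp => (hxy i p hp).1.continuousWithinAt
  choose M hM0 hM using hM
  set M₀ := M true + M false with hM₀
  have hMM : ∀ i, M i ≤ M₀ := by
    intro i; cases i <;> linarith [hM0 true, hM0 false]
  -- Subtracting `η log |t|` (`Real.log` ignores the sign) relaxes the maximum condition to `t (x -
  -- σ y) ≤ η`.
  have main : ∀ j, ∀ q ∈ Omega a b t₀, ψ j q - η * Real.log q.1 ≤ M₀ - η * Real.log t₀ ∨
      ψ j q ≤ 1 - 3 * δ / 4 := by
    intro j q hq
    obtain ⟨i, p, hp, hp1, hp2, hmax, hp3⟩ := exists_max_slab (a := a) (b := b) (t₀ := t₀)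
      (t₁ := t₀) (T := q.1) hab le_rfl hq.1 hq.2.1 s (fun i => by cases i <;> simp [s])
      (fun i q => ψ i q - η * Real.log q.1) (fun i p => x i p - (η * (p.1⁻¹ * 1) + Real.log p.1 * 0))
      (fun i p => y i p - (η * (p.1⁻¹ * 0) + Real.log p.1 * 0))
      (fun i p hp => (hxy i p hp).1.sub ((HasPD.const η).mul (hlog p hp)))
    have hqp := hmax j q hq hq.1 le_rfl
    rcases hp3 with hp3 | hp3
    · left
      rw [hp3] at hqp
      linarith [hM i p hp hp3.le, hMM i]
    · right
      have hpn := hp.2.1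
      have hlogle : Real.log q.1 ≤ Real.log p.1 := by
        rw [← Real.log_neg_eq_log, ← Real.log_neg_eq_log p.1]
        exact Real.log_le_log (by linarith [hq.2.1]) (by linarith)
      have hψ : ψ j q ≤ ψ i p := by linarith [mul_le_mul_of_nonneg_left hlogle hη0.le]
      -- Maximality over both signs makes the indefinite terms of the null derivative nonnegative;
      -- the remaining squares are then at most `η`.
      have hop := hmax (!i) p hp hp1 hp2
      have hsi : s (!i) = - s i := by cases i <;> simp [s]
      simp only [ψ, hsi] at hop
      have hsgn : 0 ≤ 2 * s i * (U p * H p + G p * F p) - l * s i * H p := by linarith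
      have hder := (hxy i p hp).2
      have hderle : p.1 * (x i p - s i * y i p) ≤ η := by
        have h1 : p.1 * p.1⁻¹ = 1 := mul_inv_cancel₀ hpn.ne
        linear_combination mul_nonpos_of_nonpos_of_nonneg hpn.le hp3 + η * h1
      have hsum : 2 * H p ^ 2 + (2 - l) * F p ^ 2 + l * G p ^ 2 ≤ l * ν ^ 2 := by linarith
      have hl0 : 0 < l := by positivity
      have hl1 : l ≤ 1 := by rw [hl]; linarith
      have hν0 : 0 < ν := by positivity
      have bd : ∀ z : ℝ, l * z ^ 2 ≤ l * ν ^ 2 → |z| ≤ ν := fun z hz =>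
        abs_le_of_sq_le_sq (le_of_mul_le_mul_left hz hl0) hν0.le
      have q1 := mul_nonneg (sub_nonneg.2 hl1) (sq_nonneg (H p))
      have q2 := mul_nonneg (sub_nonneg.2 hl1) (sq_nonneg (F p))
      have q3 := mul_nonneg hl0.le (sq_nonneg (G p))
      have bH : |H p| ≤ ν := bd _ (by linarith [sq_nonneg (H p), sq_nonneg (F p)])
      have bF : |F p| ≤ ν := bd _ (by linarith [sq_nonneg (H p)])
      have bG : |G p| ≤ ν := bd _ (by linarith [sq_nonneg (H p), sq_nonneg (F p)])
      exact hψ.trans (corrected_velocity_sq_le hδ hδ1 (hs i) (hU p hp) bG bH bF)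
  -- Once `log |t| ≤ c`, the alternative coming from the initial slice gives the same bound.
  set c := (1 - 3 * δ / 4 - M₀) / η + Real.log t₀ with hc
  refine ⟨max t₀ (- Real.exp c), le_max_left _ _, max_lt ht₀ (by simp [Real.exp_pos]),
    1 - 5 * δ / 8, by linarith, by linarith, fun σ hσ p hp htp => ?_⟩
  have hle : ∀ i, ψ i p ≤ 1 - 3 * δ / 4 := by
    intro i
    rcases main i p hp with hm | hm
    · have h1 : Real.log p.1 ≤ c := by
        rw [← Real.log_neg_eq_log, Real.log_le_iff_le_exp (by linarith [hp.2.1])]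
        linarith [le_max_right t₀ (- Real.exp c)]
      have h2 : η * c = 1 - 3 * δ / 4 - M₀ + η * Real.log t₀ := by
        rw [hc]; field_simp
      nlinarith
    · exact hm
  have fin : ∀ i, (U p + s i * H p) * (U p + s i * H p) +
      (G p + s i * F p) * (G p + s i * F p) ≤ 1 - 5 * δ / 8 := by
    intro i
    have := hle i
    simp only [ψ] at this
    -- Removing the correction then costs at most `2 l = δ / 8`.
    have h2 : U p + s i * H p ≤ 2 := by
      by_contra! hcon
      nlinarith [mul_self_nonneg (G p + s i * F p)]
    nlinarith
  rcases mul_self_eq_one_iff.1 hσ with rfl | rfl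
  · simpa [s] using fin true
  · simpa [s] using fin false

end FirstOrderSystem

/-! ### Damping and weighted bounds for the derivatives. -/

/-- Since `|z| ≤ c |x|`, Cauchy–Schwarz gives `2 x·z ≥ -2c |x|²`, which the damping `2k |x|²` beats.
-/
lemma sq_sum_nonpos_of_damped {c k x₁ x₂ z₁ z₂ : ℝ} (hc : 0 < c) (hck : c < k)
    (hz : z₁ ^ 2 + z₂ ^ 2 ≤ c ^ 2 * (x₁ ^ 2 + x₂ ^ 2))
    (h : 2 * (x₁ * z₁ + x₂ * z₂) + 2 * k * (x₁ ^ 2 + x₂ ^ 2) ≤ 0) : x₁ ^ 2 + x₂ ^ 2 ≤ 0 := by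
  by_contra! hX
  have h1 : 0 ≤ (c * x₁ + z₁) ^ 2 + (c * x₂ + z₂) ^ 2 := by positivity
  have h2 : c * (2 * (x₁ * z₁ + x₂ * z₂) + 2 * k * (x₁ ^ 2 + x₂ ^ 2)) ≤ 0 :=
    mul_nonpos_of_nonneg_of_nonpos hc.le h
  have h3 : 0 < c * ((k - c) * (x₁ ^ 2 + x₂ ^ 2)) :=
    mul_pos hc (mul_pos (sub_pos.2 hck) hX)
  nlinarith

/-- Here `|r m| ≤ E √(X N) ≤ (E / c) N`, and `E / c < k`. -/
lemma nonpos_of_damped {c k E N X r m : ℝ} (hc : 0 < c) (hE : 0 ≤ E) (hEck : E < c * k)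
    (hN : 0 ≤ N) (hX : c ^ 2 * X ≤ N) (hr : r ^ 2 ≤ X * E) (hm : m ^ 2 ≤ N * E)
    (h : 2 * (r * m) + 2 * k * N ≤ 0) : N ≤ 0 := by
  have h1 : (c * (r * m)) ^ 2 ≤ (N * E) ^ 2 := by
    calc (c * (r * m)) ^ 2 = c ^ 2 * r ^ 2 * m ^ 2 := by ring
      _ ≤ c ^ 2 * (X * E) * (N * E) := by
        have := (sq_nonneg r).trans hr
        gcongr
      _ = (c ^ 2 * X) * E * (N * E) := by ring
      _ ≤ N * E * (N * E) := by gcongr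
      _ = (N * E) ^ 2 := by ring
  have h2 := (abs_le.1 (abs_le_of_sq_le_sq h1 (by positivity))).1
  by_contra! hN0
  have h3 := mul_nonpos_of_nonneg_of_nonpos hc.le h
  nlinarith [mul_pos hN0 (sub_pos.2 hEck)]

namespace FirstOrderSystem

variable {a b t₀ : ℝ} {U G H F : ℝ × ℝ → ℝ}

/-- Power law bounds on the spatial derivative and on the covariant derivatives of the null
velocities, once the latter are bounded by a constant less than `1`. -/
lemma exists_weighted_bound (hab : a < b) (ht₀ : t₀ < 0)
    (h : FirstOrderSystem (Omega a b t₀) U G H F) {t₁ E : ℝ} (ht₀₁ : t₀ ≤ t₁) (ht₁ : t₁ < 0)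
    (hE0 : 0 < E) (hE1 : E < 1)
    (hE : ∀ σ : ℝ, σ * σ = 1 → ∀ p ∈ Omega a b t₀, t₁ ≤ p.1 →
      (U p + σ * H p) * (U p + σ * H p) + (G p + σ * F p) * (G p + σ * F p) ≤ E) :
    ∃ k, 0 < k ∧ k < 1 ∧ ∃ M, 0 ≤ M ∧ ∀ p ∈ Omega a b t₀, t₁ ≤ p.1 →
      ((H p * p.1⁻¹) * (H p * p.1⁻¹) + (F p * p.1⁻¹) * (F p * p.1⁻¹)) *
        Real.exp (2 * k * Real.log p.1) ≤ M ∧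
      ∀ σ : ℝ, σ * σ = 1 →
        ((cov₁ (Omega a b t₀) F U G p + σ * cov₁ (Omega a b t₀) F H F p) *
        (cov₁ (Omega a b t₀) F U G p + σ * cov₁ (Omega a b t₀) F H F p) +
        (cov₂ (Omega a b t₀) F U G p + σ * cov₂ (Omega a b t₀) F H F p) *
        (cov₂ (Omega a b t₀) F U G p + σ * cov₂ (Omega a b t₀) F H F p)) *
        Real.exp (2 * k * Real.log p.1) ≤ M := by
  -- Both midpoints serve to get `E < c² < c k` and `c < k < 1`.
  obtain ⟨c, hc⟩ : ∃ c, c = (1 + E) / 2 := ⟨_, rfl⟩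
  obtain ⟨k, hk⟩ : ∃ k, k = (1 + c) / 2 := ⟨_, rfl⟩
  have hc0 : 0 < c := by rw [hc]; positivity
  have hck : c < k := by rw [hk]; linarith
  have hEck : E < c * k := by
    have : E < c ^ 2 := by rw [hc]; nlinarith [sq_pos_of_pos (sub_pos.2 hE1)]
    nlinarith
  refine ⟨k, hc0.trans hck, by linarith, ?_⟩
  set S := Omega a b t₀ with hS
  -- The index `none` stands for `c² |(H, F) / t|²`, followed along `∂ₜ`; `some _` stands for the
  -- two null quantities. The weight `w` is `|t| ^ (2 k)`.
  let s : Option Bool → ℝ := fun i => i.elim 0 fun j => if j then 1 else -1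
  let Z₁ : ℝ → ℝ × ℝ → ℝ := fun σ q => cov₁ S F U G q + σ * cov₁ S F H F q
  let Z₂ : ℝ → ℝ × ℝ → ℝ := fun σ q => cov₂ S F U G q + σ * cov₂ S F H F q
  let X : ℝ × ℝ → ℝ := fun q => (H q * q.1⁻¹) * (H q * q.1⁻¹) + (F q * q.1⁻¹) * (F q * q.1⁻¹)
  let N : ℝ → ℝ × ℝ → ℝ := fun σ q => Z₁ σ q * Z₁ σ q + Z₂ σ q * Z₂ σ q
  let w : ℝ × ℝ → ℝ := fun q => Real.exp (2 * k * Real.log q.1)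
  let R : Option Bool → ℝ × ℝ → ℝ := fun i p => i.elim
    (c ^ 2 * (2 * (H p * p.1⁻¹ * cov₁ S F U G p + F p * p.1⁻¹ * cov₂ S F U G p)))
    fun _ => 2 * s i * (Z₁ (s i) p * cov₁ S F H F p + Z₂ (s i) p * cov₂ S F H F p) +
        2 * ((H p * G p - F p * U p) * p.1⁻¹) *
          (Z₁ (s i) p * (G p + s i * F p) - Z₂ (s i) p * (U p + s i * H p))
  let u : Option Bool → ℝ × ℝ → ℝ := fun i => i.elim (fun q => c ^ 2 * X q) fun _ => N (s i)
  have hs : ∀ j, s (some j) * s (some j) = 1 := by intro j; cases j <;> simp [s]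
  have key : ∀ i, ∀ p : ℝ × ℝ, ∃ x y, p ∈ S → HasPD S (u i) x y p ∧
      p.1 * (x - s i * y) = R i p := by
    intro i p
    by_cases hp : p ∈ S
    · rcases i with _ | j
      · obtain ⟨x, y, hxy, hx⟩ := h.time_deriv_space hp
        refine ⟨_, _, fun _ => ⟨(HasPD.const (c ^ 2)).mul hxy, ?_⟩⟩
        simp only [s, R, Option.elim]
        linear_combination c ^ 2 * hx
      · obtain ⟨x, y, hxy⟩ := h.null_deriv_cov hab ht₀ (hs j) hp
        exact ⟨x, y, fun _ => hxy⟩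
    · exact ⟨0, 0, fun hp' => absurd hp' hp⟩
  choose x y hxy using key
  have hw : ∀ p ∈ S, HasPD S w (w p * (2 * k * (p.1⁻¹ * 1) + Real.log p.1 * 0))
      (w p * (2 * k * (p.1⁻¹ * 0) + Real.log p.1 * 0)) p := fun p hp =>
    ((HasPD.const (2 * k)).mul (HasPD.fst.comp (Real.hasDerivAt_log hp.2.1.ne))).comp
      (Real.hasDerivAt_exp _)
  have huw := fun i p (hp : p ∈ S) => (hxy i p hp).1.mul (hw p hp)
  have hM : ∀ i, ∃ M, 0 ≤ M ∧ ∀ p ∈ S, p.1 ≤ t₁ → u i p * w p ≤ M := fun i =>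
    exists_bound_slab ht₁ fun p hp => (huw i p hp).continuousWithinAt
  choose M hM0 hM using hM
  set M₀ := M none + M (some true) + M (some false) with hM₀
  have hMM : ∀ i, M i ≤ M₀ := by
    rintro (_ | _ | _) <;> linarith [hM0 none, hM0 (some true), hM0 (some false)]
  have hM₀0 : 0 ≤ M₀ := (hM0 none).trans (hMM none)
  have main : ∀ j, ∀ q ∈ S, t₁ ≤ q.1 → u j q * w q ≤ M₀ := by
    intro j q hq hqt
    obtain ⟨i, p, hp, hp1, hp2, hmax, hp3⟩ := exists_max_slab (a := a) (b := b) (t₀ := t₀)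
      (t₁ := t₁) (T := q.1) hab ht₀₁ hqt hq.2.1 s
      (fun i => by rcases i with _ | _ | _ <;> simp [s]) (fun i q => u i q * w q) _ _ huw
    refine (hmax j q hq hqt le_rfl).trans ?_
    rcases hp3 with hp3 | hp3
    · exact (hM i p hp hp3.le).trans (hMM i)
    refine le_trans ?_ hM₀0
    have hpn : p.1 < 0 := hp.2.1
    have hτ : p.1 * p.1⁻¹ = 1 := mul_inv_cancel₀ hpn.ne
    have hwp : 0 < w p := Real.exp_pos _
    have hcmp : ∀ j, u j p ≤ u i p := fun j =>
      le_of_mul_le_mul_right (hmax j p hp hp1 hp2) hwp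
    have hder : R i p + 2 * k * u i p ≤ 0 := by
      have e := (hxy i p hp).2
      have : w p * (R i p + 2 * k * u i p) ≤ 0 := by
        rw [← e]
        linear_combination mul_nonpos_of_nonpos_of_nonneg hpn.le hp3 - w p * u i p * 2 * k * hτ
      exact nonpos_of_mul_nonpos_right this hwp
    suffices u i p ≤ 0 from mul_nonpos_of_nonpos_of_nonneg this hwp.le
    clear hp3 hmax huw hw hxy
    rcases i with _ | i
    · have c1 := hcmp (some true)
      have c2 := hcmp (some false)
      simp only [u, R, N, X, Z₁, Z₂, s, Option.elim, if_true, if_false, Bool.false_eq_true] at *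
      -- Parallelogram law, averaging over the two signs.
      have hz : cov₁ S F U G p ^ 2 + cov₂ S F U G p ^ 2 ≤
          c ^ 2 * ((H p * p.1⁻¹) ^ 2 + (F p * p.1⁻¹) ^ 2) := by
        linear_combination (c1 + c2) / 2 + sq_nonneg (cov₁ S F H F p) + sq_nonneg (cov₂ S F H F p)
      have := sq_sum_nonpos_of_damped hc0 hck hz (by
        refine nonpos_of_mul_nonpos_right (a := c ^ 2) ?_ (by positivity)
        linear_combination hder)
      exact mul_nonpos_of_nonneg_of_nonpos (sq_nonneg c) (by linarith)
    · have hσ := hs i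
      have c1 := hcmp none
      have c2 := hcmp (some !i)
      have hsi : s (some !i) = - s (some i) := by cases i <;> simp [s]
      have hE1 := hE _ hσ p hp hp1
      have hE2 := hE (- s (some i)) (by linarith) p hp hp1
      simp only [u, R, N, X, Option.elim, hsi] at c1 c2 hder ⊢
      generalize hσs : s (some i) = σ at *
      -- The expression is `Z_σ · (Z_σ - Z_{-σ})`, nonnegative because `|Z_{-σ}| ≤ |Z_σ|` at the
      -- maximum.
      have hsgn : 0 ≤ 2 * σ * (Z₁ σ p * cov₁ S F H F p + Z₂ σ p * cov₂ S F H F p) := by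
        have e1 : 2 * σ * cov₁ S F H F p = Z₁ σ p - Z₁ (-σ) p := by simp only [Z₁]; ring
        have e2 : 2 * σ * cov₂ S F H F p = Z₂ σ p - Z₂ (-σ) p := by simp only [Z₂]; ring
        have : 2 * σ * (Z₁ σ p * cov₁ S F H F p + Z₂ σ p * cov₂ S F H F p) =
          Z₁ σ p * (Z₁ σ p - Z₁ (-σ) p) + Z₂ σ p * (Z₂ σ p - Z₂ (-σ) p) := by
            rw [← e1, ← e2]; ring
        rw [this]
        linear_combination (c2 + sq_nonneg (Z₁ σ p - Z₁ (-σ) p) + sq_nonneg (Z₂ σ p - Z₂ (-σ) p)) / 2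
      -- Both `r` and `m` are determinants against a null velocity, so Lagrange's identity bounds
      -- their squares with the factor `E`. For `r`, adding a multiple of `(H, F)` to `(U, G)`
      -- changes nothing.
      refine nonpos_of_damped (X := X p) (r := (H p * G p - F p * U p) * p.1⁻¹)
        (m := Z₁ σ p * (G p + σ * F p) - Z₂ σ p * (U p + σ * H p)) hc0 hE0.le hEck
        (add_nonneg (mul_self_nonneg _) (mul_self_nonneg _)) c1 ?_ ?_ (by linarith)
      · refine le_trans ?_ (mul_le_mul_of_nonneg_left hE2
          (add_nonneg (mul_self_nonneg _) (mul_self_nonneg _)))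
        have := sq_nonneg ((H p * p.1⁻¹) * (U p + -σ * H p) + (F p * p.1⁻¹) * (G p + -σ * F p))
        linear_combination this
      · refine le_trans ?_ (mul_le_mul_of_nonneg_left hE1
          (add_nonneg (mul_self_nonneg _) (mul_self_nonneg _)))
        have := sq_nonneg (Z₁ σ p * (U p + σ * H p) + Z₂ σ p * (G p + σ * F p))
        linear_combination this
  refine ⟨M₀ + M₀ / c ^ 2, by positivity, fun p hp hpt => ⟨?_, fun σ hσ => ?_⟩⟩
  · have := main none p hp hpt
    have h2 : X p * w p ≤ M₀ / c ^ 2 := by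
      rw [le_div_iff₀ (by positivity)]
      calc X p * w p * c ^ 2 = c ^ 2 * X p * w p := by ring
        _ ≤ M₀ := this
    exact h2.trans (by linarith)
  · have h0 : 0 ≤ M₀ / c ^ 2 := by positivity
    rcases mul_self_eq_one_iff.1 hσ with rfl | rfl
    · exact (main (some true) p hp hpt).trans (by linarith)
    · exact (main (some false) p hp hpt).trans (by linarith)

end FirstOrderSystem

/-! ### Integration in time and the asymptotics. -/

/-- A family of functions whose derivative is bounded by an integrable power converges
uniformly. -/
lemma exists_tendstoUniformlyOn_of_deriv_le {V V' : ℝ → ℝ → ℝ} {I : Set ℝ} {t₁ C k K : ℝ}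
    (ht₁ : t₁ < 0) (hk : k < 1) (hC : 0 ≤ C)
    (hV : ∀ θ ∈ I, ∀ t ∈ Ioo t₁ 0, HasDerivAt (fun s => V s θ) (V' t θ) t)
    (hV' : ∀ θ ∈ I, ∀ t ∈ Ioo t₁ 0, |V' t θ| ≤ C * (-t) ^ (-k))
    (hK : ∀ θ ∈ I, ∀ t ∈ Ioo t₁ 0, V t θ ≤ K) :
    ∃ L : ℝ → ℝ, TendstoUniformlyOn V L (𝓝[<] (0 : ℝ)) I := by
  have hk' : 0 < 1 - k := by linarith
  -- `B` is the integral of the derivative bound from `t` to `0`. Thus `V - B` increases and `V + B`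
  -- decreases, so `V` stays within `B` of its limit.
  set B : ℝ → ℝ := fun t => C / (1 - k) * (-t) ^ (1 - k) with hB
  have hB0 : ∀ t, t < 0 → 0 ≤ B t := fun t ht =>
    mul_nonneg (div_nonneg hC hk'.le) (Real.rpow_nonneg (by linarith) _)
  have hBd : ∀ t ∈ Ioo t₁ 0, HasDerivAt B (-(C * (-t) ^ (-k))) t := by
    intro t ht
    have h1 := ((hasDerivAt_id t).neg.rpow_const (p := 1 - k)
      (Or.inl (by simpa using ht.2.ne))).const_mul (C / (1 - k))
    refine h1.congr_deriv ?_
    simp only [id, Pi.neg_apply, show 1 - k - 1 = -k by ring]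
    field_simp
  have hBlim : Tendsto B (𝓝[<] 0) (𝓝 0) := by
    have : ContinuousAt B 0 := by
      refine continuousAt_const.mul ?_
      exact continuousAt_neg.rpow_const (Or.inr hk'.le)
    have h0 : B 0 = 0 := by simp [hB, Real.zero_rpow hk'.ne']
    have h1 := this.tendsto
    rw [h0] at h1
    exact h1.mono_left nhdsWithin_le_nhds
  have hne : (Ioo t₁ 0).Nonempty := nonempty_Ioo.2 ht₁
  have hmono : ∀ θ ∈ I, MonotoneOn (fun t => V t θ - B t) (Ioo t₁ 0) := fun θ hθ =>
    monotoneOn_of_hasDerivWithinAt_nonneg (convex_Ioo _ _)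
      (fun t ht => ((hV θ hθ t ht).sub (hBd t ht)).continuousAt.continuousWithinAt)
      (fun t ht => ((hV θ hθ t (interior_subset ht)).sub
        (hBd t (interior_subset ht))).hasDerivWithinAt)
      (fun t ht => by
        have := neg_abs_le (V' t θ)
        linarith [hV' θ hθ t (interior_subset ht)])
  have hanti : ∀ θ ∈ I, AntitoneOn (fun t => V t θ + B t) (Ioo t₁ 0) := fun θ hθ =>
    antitoneOn_of_hasDerivWithinAt_nonpos (convex_Ioo _ _)
      (fun t ht => ((hV θ hθ t ht).add (hBd t ht)).continuousAt.continuousWithinAt)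
      (fun t ht => ((hV θ hθ t (interior_subset ht)).add
        (hBd t (interior_subset ht))).hasDerivWithinAt)
      (fun t ht => by
        have := le_abs_self (V' t θ)
        linarith [hV' θ hθ t (interior_subset ht)])
  have hlim : ∀ θ, ∃ l, θ ∈ I → Tendsto (fun t => V t θ) (𝓝[<] 0) (𝓝 l) := by
    intro θ
    by_cases hθ : θ ∈ I
    · have := (MonotoneOn.tendsto_nhdsWithin_Ioo_left hne (hmono θ hθ) ⟨K, by
        rintro _ ⟨t, ht, rfl⟩
        exact (sub_le_self _ (hB0 t ht.2)).trans (hK θ hθ t ht)⟩).add hBlim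
      exact ⟨_, fun _ => by simpa using this⟩
    · exact ⟨0, fun h => absurd h hθ⟩
  choose L hL using hlim
  have hdist : ∀ θ ∈ I, ∀ t ∈ Ioo t₁ 0, |V t θ - L θ| ≤ B t := by
    intro θ hθ t ht
    have hev : ∀ᶠ s in 𝓝[<] (0 : ℝ), s ∈ Ioo t 0 := Ioo_mem_nhdsLT ht.2
    have h1 : V t θ - B t ≤ L θ := by
      have := (hL θ hθ).sub hBlim
      rw [sub_zero] at this
      refine ge_of_tendsto this (hev.mono fun s hs => ?_)
      exact hmono θ hθ ht ⟨ht.1.trans hs.1, hs.2⟩ hs.1.le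
    have h2 : L θ ≤ V t θ + B t := by
      have := (hL θ hθ).add hBlim
      rw [add_zero] at this
      refine le_of_tendsto this (hev.mono fun s hs => ?_)
      exact hanti θ hθ ht ⟨ht.1.trans hs.1, hs.2⟩ hs.1.le
    rw [abs_le]
    constructor <;> linarith
  refine ⟨L, Metric.tendstoUniformlyOn_iff.2 fun e he => ?_⟩
  filter_upwards [hBlim.eventually (gt_mem_nhds he), Ioo_mem_nhdsLT ht₁] with t h1 h2 θ hθ
  rw [dist_comm, Real.dist_eq]
  exact (hdist θ hθ t h2).trans_lt h1

namespace FirstOrderSystem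

variable {a b t₀ : ℝ} {U G H F : ℝ × ℝ → ℝ}

lemma mem_Omega_of_mem_Icc {t θ : ℝ} (ht : t₀ ≤ t) (ht0 : t < 0) (hθ : θ ∈ Icc a b) :
    (t, θ) ∈ Omega a b t₀ :=
  ⟨ht, ht0, by simp only; linarith [hθ.1], by simp only; linarith [hθ.2]⟩

/-- Asymptotics of the first order system when `|U|` is bounded away from `1`. -/
lemma asymptotics (hab : a < b) (ht₀ : t₀ < 0)
    (h : FirstOrderSystem (Omega a b t₀) U G H F) {δ : ℝ} (hδ : 0 < δ)
    (hU : ∀ p ∈ Omega a b t₀, |U p| ≤ 1 - δ) :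
    (∃ v : ℝ → ℝ, ContinuousOn v (Icc a b) ∧
      TendstoUniformlyOn (fun t θ => |U (t, θ)| ^ 2 + |G (t, θ)| ^ 2)
        (fun θ => v θ ^ 2) (𝓝[<] (0 : ℝ)) (Icc a b)) ∧
    (∃ C > (0 : ℝ), ∃ ε > (0 : ℝ), ∀ t θ : ℝ, (t, θ) ∈ Omega a b t₀ →
      |F (t, θ)| ^ 2 + |H (t, θ)| ^ 2 ≤ C * |t| ^ (2 * ε)) := by
  obtain ⟨t₁, ht₀₁, ht₁, E, hE0, hE1, hE⟩ := h.exists_null_velocity_lt_one hab ht₀ hδ hU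
  obtain ⟨k, hk0, hk1, M, hM0, hM⟩ := h.exists_weighted_bound hab ht₀ ht₀₁ ht₁ hE0 hE1 hE
  have hexp : ∀ t : ℝ, t < 0 → Real.exp (2 * k * Real.log t) = (-t) ^ (2 * k) := fun t ht => by
    rw [Real.rpow_def_of_pos (by linarith), Real.log_neg_eq_log, mul_comm]
  simp only [sq_abs]
  constructor
  · have hder : ∀ θ ∈ Icc a b, ∀ t ∈ Ioo t₁ 0,
        HasDerivAt (fun s => U (s, θ) ^ 2 + G (s, θ) ^ 2)
          (2 * (U (t, θ) * cov₁ (Omega a b t₀) F H F (t, θ) +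
            G (t, θ) * cov₂ (Omega a b t₀) F H F (t, θ))) t := by
      intro θ hθ t ht
      obtain ⟨y, L, hL, hL1, -⟩ :=
        h.time_deriv_velocity (mem_Omega_of_mem_Icc (ht₀₁.trans ht.1.le) ht.2 hθ)
      have hpath : HasDerivWithinAt (fun s : ℝ => (s, θ)) ((1, 0) : ℝ × ℝ) (Ioo t₁ 0) t :=
        ((hasDerivAt_id t).prodMk (hasDerivAt_const t θ)).hasDerivWithinAt
      have := hL.comp_hasDerivWithinAt t hpath
        (fun s hs => mem_Omega_of_mem_Icc (ht₀₁.trans hs.1.le) hs.2 hθ)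
      rw [hL1] at this
      refine (this.hasDerivAt (Ioo_mem_nhds ht.1 ht.2)).congr_of_eventuallyEq
        (Eventually.of_forall fun s => ?_)
      simp only [Function.comp]
      ring
    have hvel : ∀ θ ∈ Icc a b, ∀ t ∈ Ioo t₁ 0, U (t, θ) ^ 2 + G (t, θ) ^ 2 ≤ 1 := by
      intro θ hθ t ht
      have hp := mem_Omega_of_mem_Icc (t₀ := t₀) (ht₀₁.trans ht.1.le) ht.2 hθ
      have h1 := hE 1 (by norm_num) _ hp ht.1.le
      have h2 := hE (-1) (by norm_num) _ hp ht.1.le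
      linarith [sq_nonneg (H (t, θ)), sq_nonneg (F (t, θ))]
    have hbound : ∀ θ ∈ Icc a b, ∀ t ∈ Ioo t₁ 0,
        |2 * (U (t, θ) * cov₁ (Omega a b t₀) F H F (t, θ) +
            G (t, θ) * cov₂ (Omega a b t₀) F H F (t, θ))| ≤ 2 * √M * (-t) ^ (-k) := by
      intro θ hθ t ht
      have hp := mem_Omega_of_mem_Icc (t₀ := t₀) (ht₀₁.trans ht.1.le) ht.2 hθ
      have hv := hvel θ hθ t ht
      have h1 := (hM _ hp ht.1.le).2 1 (by norm_num)
      have h2 := (hM _ hp ht.1.le).2 (-1) (by norm_num)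
      have hw : (-t) ^ (2 * k) = ((-t) ^ k) ^ 2 := by
        rw [mul_comm, Real.rpow_mul (by linarith [ht.2])]; norm_num
      have ht' : 0 < -t := by linarith [ht.2]
      simp only [hexp t ht.2, hw] at h1 h2
      rw [Real.rpow_neg ht'.le, ← div_eq_mul_inv, le_div_iff₀ (Real.rpow_pos_of_pos ht' k)]
      have hw0 := Real.rpow_pos_of_pos ht' k
      generalize (-t) ^ k = w at *
      generalize cov₁ (Omega a b t₀) F H F (t, θ) = z₁ at *
      generalize cov₂ (Omega a b t₀) F H F (t, θ) = z₂ at *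
      generalize cov₁ (Omega a b t₀) F U G (t, θ) = y₁ at *
      generalize cov₂ (Omega a b t₀) F U G (t, θ) = y₂ at *
      generalize U (t, θ) = u at *
      generalize G (t, θ) = g at *
      have hz : (z₁ ^ 2 + z₂ ^ 2) * w ^ 2 ≤ M := by
        linear_combination (h1 + h2) / 2 + sq_nonneg (y₁ * w) + sq_nonneg (y₂ * w)
      -- Cauchy–Schwarz with `u² + g² ≤ 1`.
      have hsq : ((u * z₁ + g * z₂) * w) ^ 2 ≤ M := by
        have c1 := mul_le_mul hv hz (by positivity) zero_le_one
        have c2 := sq_nonneg ((u * z₂ - g * z₁) * w)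
        linear_combination c1 + c2
      have := Real.abs_le_sqrt hsq
      rw [abs_mul, abs_of_pos hw0] at this
      rw [abs_mul, abs_two]
      linarith
    obtain ⟨L, hL⟩ := exists_tendstoUniformlyOn_of_deriv_le (C := 2 * √M) ht₁ hk1
      (by positivity) hder hbound hvel
    have hnn : ∀ θ ∈ Icc a b, 0 ≤ L θ := fun θ hθ =>
      ge_of_tendsto (hL.tendsto_at hθ) (Eventually.of_forall fun t => by positivity)
    have hcont : ContinuousOn L (Icc a b) := by
      refine hL.continuousOn (Eventually.frequently ?_)
      filter_upwards [Ioo_mem_nhdsLT ht₁] with t ht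
      have hmap : MapsTo (fun θ : ℝ => (t, θ)) (Icc a b) (Omega a b t₀) := fun θ hθ =>
        mem_Omega_of_mem_Icc (ht₀₁.trans ht.1.le) ht.2 hθ
      have hc : ContinuousOn (fun θ : ℝ => (t, θ)) (Icc a b) := by fun_prop
      exact ((h.smooth_U.continuousOn.comp hc hmap).pow 2).add
        ((h.smooth_G.continuousOn.comp hc hmap).pow 2)
    exact ⟨fun θ => √(L θ), hcont.sqrt, hL.congr_right fun θ hθ => (Real.sq_sqrt (hnn θ hθ)).symm⟩
  · obtain ⟨M', hM'0, hM'⟩ := exists_bound_slab (a := a) (b := b) (t₀ := t₀) ht₁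
      (u := fun p => F p ^ 2 + H p ^ 2)
      ((h.smooth_F.continuousOn.pow 2).add (h.smooth_H.continuousOn.pow 2))
    have hpow : 0 < |t₁| ^ (2 * (1 - k)) := Real.rpow_pos_of_pos (abs_pos.2 ht₁.ne) _
    -- `M` serves for `t ≥ t₁`, the quotient for the compact slab `t ≤ t₁`, and `1` ensures
    -- positivity.
    refine ⟨M + M' / |t₁| ^ (2 * (1 - k)) + 1, by positivity, 1 - k, by linarith,
      fun t θ hp => ?_⟩
    have ht : t < 0 := hp.2.1
    have hpt : 0 < |t| ^ (2 * (1 - k)) := Real.rpow_pos_of_pos (abs_pos.2 ht.ne) _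
    rcases le_total t₁ t with htt | htt
    · have h1 := (hM _ hp htt).1
      simp only [hexp t ht] at h1
      have hw : (-t) ^ (2 * k) * |t| ^ (2 * (1 - k)) = t ^ 2 := by
        rw [abs_of_neg ht, ← Real.rpow_add (by linarith),
          show 2 * k + 2 * (1 - k) = (2 : ℕ) by push_cast; ring, Real.rpow_natCast, neg_sq]
      have h2 := mul_le_mul_of_nonneg_right h1 hpt.le
      have h3 : (H (t, θ) * t⁻¹ * (H (t, θ) * t⁻¹) + F (t, θ) * t⁻¹ * (F (t, θ) * t⁻¹)) *
          (-t) ^ (2 * k) * |t| ^ (2 * (1 - k)) = F (t, θ) ^ 2 + H (t, θ) ^ 2 := by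
        rw [mul_assoc, hw]
        have := ht.ne
        field_simp
        ring
      rw [h3] at h2
      refine h2.trans (mul_le_mul_of_nonneg_right ?_ hpt.le)
      have : 0 ≤ M' / |t₁| ^ (2 * (1 - k)) := by positivity
      linarith
    · have h1 : |t₁| ^ (2 * (1 - k)) ≤ |t| ^ (2 * (1 - k)) := by
        refine Real.rpow_le_rpow (abs_nonneg _) ?_ (by linarith)
        rw [abs_of_neg ht, abs_of_neg ht₁]
        linarith
      calc F (t, θ) ^ 2 + H (t, θ) ^ 2 ≤ M' := hM' _ hp htt
        _ = M' / |t₁| ^ (2 * (1 - k)) * |t₁| ^ (2 * (1 - k)) := by field_simp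
        _ ≤ M' / |t₁| ^ (2 * (1 - k)) * |t| ^ (2 * (1 - k)) := by gcongr
        _ ≤ _ := by
          refine mul_le_mul_of_nonneg_right ?_ hpt.le
          linarith

end FirstOrderSystem

/-! ### Consequences of the smallness conditions. -/

section Conditions

variable {S : Set (ℝ × ℝ)} {P Q : ℝ × ℝ → ℝ}

lemma SupLT.exists_le {f : ℝ × ℝ → ℝ} {c : ℝ} (h : SupLT S f c) :
    ∃ d < c, ∀ p ∈ S, f p ≤ d :=
  ⟨_, h.2, fun p hp => le_csSup h.1 ⟨p, hp, rfl⟩⟩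

lemma CondA.exists_abs_le (h : CondA S P Q) :
    ∃ δ > (0 : ℝ), ∀ p ∈ S, |p.1 * f₁ S P p + 1| ≤ 1 - δ := by
  obtain ⟨d, hd, hS⟩ := h.exists_le
  refine ⟨1 - d, by linarith, fun p hp => ?_⟩
  have := hS p hp
  have h1 : 0 ≤ |p.1 * g₂ S P Q p| / 2 := by positivity
  have h2 : 0 ≤ 2 * |p.1 * f₂ S P Q p| ^ 2 /
    (Real.sqrt (1 + 4 * |p.1 * f₂ S P Q p| ^ 2) + 1) := by positivity
  linarith

/-- The square root dominates `μ̂₋ + |U + H|`, so the first expression is at least `2 (|U - H| + |U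
+ H|) ≥ 4 |U|`. -/
lemma CondB.exists_abs_le (h : CondB S P Q) :
    ∃ δ > (0 : ℝ), ∀ p ∈ S, |p.1 * f₁ S P p + 1| ≤ 1 - δ := by
  obtain ⟨d, hd, hS⟩ := h.1.exists_le
  obtain ⟨e, he, hS'⟩ := h.2.exists_le
  -- The second half of the condition is needed only here: `sSup` bounds nothing unless the set is
  -- bounded above.
  have hbdd : BddAbove ((fun p : ℝ × ℝ => |p.1 * f₁ S P p + 1 - p.1 * g₁ S P p|) '' S) := by
    refine ⟨e - muPlus S P, ?_⟩
    rintro _ ⟨p, hp, rfl⟩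
    have := hS' p hp
    have h1 := Real.sqrt_nonneg ((muPlus S P + |p.1 * f₁ S P p + 1 - p.1 * g₁ S P p|) ^ 2 +
      4 * |p.1 * f₂ S P Q p - p.1 * g₂ S P Q p| ^ 2)
    simp only
    linarith
  refine ⟨(4 - d) / 4, by linarith, fun p hp => ?_⟩
  have h0 := hS p hp
  have h1 : muMinus S P + |p.1 * f₁ S P p + 1 + p.1 * g₁ S P p| ≤
      Real.sqrt ((muMinus S P + |p.1 * f₁ S P p + 1 + p.1 * g₁ S P p|) ^ 2 +
      4 * |p.1 * f₂ S P Q p + p.1 * g₂ S P Q p| ^ 2) :=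
    Real.le_sqrt_of_sq_le (le_add_of_nonneg_right (by positivity))
  have h2 : |p.1 * f₁ S P p + 1 - p.1 * g₁ S P p| ≤ muMinus S P :=
    le_csSup hbdd ⟨p, hp, rfl⟩
  have h3 := abs_add_le (p.1 * f₁ S P p + 1 + p.1 * g₁ S P p) (p.1 * f₁ S P p + 1 - p.1 * g₁ S P p)
  rw [show p.1 * f₁ S P p + 1 + p.1 * g₁ S P p + (p.1 * f₁ S P p + 1 - p.1 * g₁ S P p) =
    2 * (p.1 * f₁ S P p + 1) by ring, abs_mul, abs_two] at h3
  linarith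

end Conditions

end Gowdy

theorem mainTheorem9 (a b t₀ : ℝ) (hab : a < b) (ht₀ : t₀ < 0) (P Q : ℝ × ℝ → ℝ)
    (hx : Gowdy.IsSolutionOn (Gowdy.Omega a b t₀) P Q)
    (hcond : Gowdy.CondA (Gowdy.Omega a b t₀) P Q ∨ Gowdy.CondB (Gowdy.Omega a b t₀) P Q) :
    (∃ v : ℝ → ℝ, ContinuousOn v (Icc a b) ∧
      TendstoUniformlyOn
        (fun t θ => |t * Gowdy.f₁ (Gowdy.Omega a b t₀) P (t, θ) + 1| ^ 2 +
          |t * Gowdy.g₂ (Gowdy.Omega a b t₀) P Q (t, θ)| ^ 2)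
        (fun θ => v θ ^ 2) (𝓝[<] (0 : ℝ)) (Icc a b)) ∧
    (∃ C > (0 : ℝ), ∃ ε > (0 : ℝ), ∀ t θ : ℝ, (t, θ) ∈ Gowdy.Omega a b t₀ →
      |t * Gowdy.f₂ (Gowdy.Omega a b t₀) P Q (t, θ)| ^ 2 +
        |t * Gowdy.g₁ (Gowdy.Omega a b t₀) P (t, θ)| ^ 2 ≤ C * |t| ^ (2 * ε)) := by
  obtain ⟨δ, hδ, hU⟩ := hcond.elim Gowdy.CondA.exists_abs_le Gowdy.CondB.exists_abs_le
  exact (hx.firstOrderSystem hab ht₀).asymptotics hab ht₀ hδ hU
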